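/- **Conventions.** A relational signature is a finite set $\sigma = \sigma_{\mathcal B} \sqcup \sigma_{\mathcal D}$ of relation symbols with arities, split into base relations $\sigma_{\mathcal B}$ and distinguished relations $\sigma_{\mathcal D}$, where the distinguished relations are binary; its arity is the maximal arity of its relations. A fact is an expression $R(\vec a)$ with $R \in \sigma$ and $\vec a$ a tuple of elements whose length is the arity of $R$. A disjunctive inclusion dependency (DID) is a sentence $\forall \vec x\, \bigl(R(\vec x) \rightarrow \bigvee_{1 \le i \le n} \exists \vec y_i\, S_i(\vec x, \vec y_i)\bigr)$ with $n \ge 1$ and $R, S_1, \dots, S_n \in \sigma$, in which no variable occurs twice in the same atom (an atom $S_i(\vec x,\vec y_i)$ may use any of the variables $\vec x$, in any order). The relations of a DID may be base or distinguished. A Boolean conjunctive query (CQ) on $\sigma_{\mathcal B}$ is a sentence $\exists \vec x\, \varphi$ with $\varphi$ a conjunction of equalities and of atoms over relations of $\sigma_{\mathcal B}$. For a finite set of facts $\mathcal F_0$, a finite set $\Sigma$ of DIDs and a CQ $Q$, the problem $\mathrm{QAtr}(\mathcal F_0, \Sigma, Q)$ asks whether there is no finite or infinite set of facts $\mathcal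 F \supseteq \mathcal F_0$ that satisfies $\Sigma$, does not satisfy $Q$, and in which every relation of $\sigma_{\mathcal D}$ is transitive. **Theorem.** There are a signature $\sigma = \sigma_{\mathcal B} \sqcup \sigma_{\mathcal D}$ of arity two with exactly one distinguished relation $S^+$ in $\sigma_{\mathcal D}$, a finite set $\Sigma$ of DIDs on $\sigma$, and a CQ $Q$ on $\sigma_{\mathcal B}$, such that the following problem is undecidable: given a finite set of facts $\mathcal F_0$ over $\sigma$, decide $\mathrm{QAtr}(\mathcal F_0, \Sigma, Q)$. -/

import Mathlib

namespace QueryAnswering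

/-- A finite relational signature `σ = σ_B ⊔ σ_D`: finitely many relation symbols with their
arities, some of which are distinguished (and then binary); the other ones are base relations. -/
structure Signature where
  numRel : ℕ
  arity : Fin numRel → ℕ
  distinguished : Finset (Fin numRel)
  arity_distinguished : ∀ R ∈ distinguished, arity R = 2

namespace Signature

/-- The relation symbols of `σ`. -/
abbrev Rel (σ : Signature) : Type := Fin σ.numRel

/-- The arity of the signature: the maximal arity of its relations. -/
def maxArity (σ : Signature) : ℕ := Finset.univ.sup σ.arity

end Signature

/-- `R(t₁, …, tₙ)` with `R` in `σ`, `n` the arity of `R`, and `t₁, …, tₙ` in `α`. When `α` is a set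
of elements this is a fact; when `α` is a set of variables it is a relational atom. -/
@[ext] structure Atom (σ : Signature) (α : Type) where
  rel : σ.Rel
  args : List α
  length_args : args.length = σ.arity rel

namespace Atom

/-- Replace every argument `t` by `h t`. -/
def map {σ : Signature} {α β : Type} (h : α → β) (A : Atom σ α) : Atom σ β where
  rel := A.rel
  args := A.args.map h
  length_args := by rw [List.length_map, A.length_args]

/-- An atom is a relation symbol with a list of arguments of the right length. -/
def equivSubtype (σ : Signature) (α : Type) :
    Atom σ α ≃ {p : σ.Rel × List α // p.2.length = σ.arity p.1} where
  toFun A := ⟨(A.rel, A.args), A.length_args⟩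
  invFun p := ⟨p.1.1, p.1.2, p.2⟩
  left_inv _ := rfl
  right_inv _ := rfl

theorem primrecPred_length (σ : Signature) :
    PrimrecPred fun p : σ.Rel × List ℕ => p.2.length = σ.arity p.1 :=
  Primrec.eq.comp (Primrec.list_length.comp Primrec.snd)
    ((Primrec.dom_finite σ.arity).comp Primrec.fst)

/-- The effective encoding of facts whose elements are natural numbers. -/
instance instPrimcodable (σ : Signature) : Primcodable (Atom σ ℕ) :=
  letI : Primcodable {p : σ.Rel × List ℕ // p.2.length = σ.arity p.1} :=
    Primcodable.subtype (primrecPred_length σ)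
  Primcodable.ofEquiv _ (equivSubtype σ ℕ)

end Atom

/-- A finite or infinite set of facts over `σ`, with elements in `D`. -/
abbrev FactSet (σ : Signature) (D : Type) : Type := Set (Atom σ D)

namespace FactSet

variable {σ : Signature} {D : Type}

/-- The domain of `F`: the elements that occur as arguments of facts of `F`. -/
def elems (F : FactSet σ D) : Set D := {d | ∃ A ∈ F, d ∈ A.args}

/-- The fact `R(a, b)` is in `F`. -/
def Holds₂ (F : FactSet σ D) (R : σ.Rel) (a b : D) : Prop :=
  ∃ A ∈ F, A.rel = R ∧ A.args = [a, b]

/-- Every distinguished relation is transitive in `F`. -/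
def DistinguishedTransitive (F : FactSet σ D) : Prop :=
  ∀ R ∈ σ.distinguished, ∀ a b c : D, F.Holds₂ R a b → F.Holds₂ R b c → F.Holds₂ R a c

end FactSet

/-- Atomic formulas over `σ` (with variables `0, 1, 2, …`): relational atoms and equalities. -/
inductive AtomicFormula (σ : Signature) where
  | rel (A : Atom σ ℕ)
  | eq (x y : ℕ)

namespace AtomicFormula

variable {σ : Signature}

/-- The variables of an atomic formula. -/
def vars : AtomicFormula σ → List ℕ
  | rel A => A.args
  | eq x y => [x, y]

/-- The atomic formula is true in `F` under the assignment `h`. -/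
def Holds {D : Type} (F : FactSet σ D) (h : ℕ → D) : AtomicFormula σ → Prop
  | rel A => A.map h ∈ F
  | eq x y => h x = h y

/-- The atomic formula uses no distinguished relation. -/
def OnBase : AtomicFormula σ → Prop
  | rel A => A.rel ∉ σ.distinguished
  | eq _ _ => True

end AtomicFormula

/-- A Boolean conjunctive query: the existential closure of the conjunction of its atoms. -/
structure CQ (σ : Signature) where
  atoms : List (AtomicFormula σ)

namespace CQ

variable {σ : Signature}

/-- `F` satisfies the query. Variables range over the domain of `F`. -/
def Holds {D : Type} (F : FactSet σ D) (Q : CQ σ) : Prop :=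
  ∃ h : ℕ → D, ∀ φ ∈ Q.atoms, (∀ x ∈ φ.vars, h x ∈ F.elems) ∧ φ.Holds F h

/-- The query is on the base signature `σ_B`. -/
def OnBase (Q : CQ σ) : Prop := ∀ φ ∈ Q.atoms, φ.OnBase

end CQ

/-- A disjunctive inclusion dependency `∀ x, R(x) → ⋁ i, ∃ yᵢ, Sᵢ(x, yᵢ)`, with at least one
disjunct, where no variable occurs twice in the same atom. Every `Sᵢ` may use any of the body
variables, in any order; its other variables are existentially quantified. -/
structure DID (σ : Signature) where
  body : Atom σ ℕ
  heads : List (Atom σ ℕ)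
  heads_ne_nil : heads ≠ []
  nodup_body : body.args.Nodup
  nodup_heads : ∀ A ∈ heads, A.args.Nodup

/-- `F` satisfies the dependency. -/
def DID.Holds {σ : Signature} {D : Type} (F : FactSet σ D) (τ : DID σ) : Prop :=
  ∀ h : ℕ → D, τ.body.map h ∈ F →
    ∃ A ∈ τ.heads, ∃ h' : ℕ → D, (∀ x ∈ τ.body.args, h' x = h x) ∧ A.map h' ∈ F

/-- `F₀` and `T` entail `Q` over transitive relations: there is no set of facts `F`, finite or
infinite, that contains `F₀`, satisfies `T`, violates `Q`, and in which every distinguished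
relation is transitive. The elements of `F₀` are natural numbers; those of `F` are taken in any
set `D` that contains the natural numbers (through `e`). -/
def EntailsTr {σ : Signature} (F₀ : FactSet σ ℕ) (T : List (DID σ)) (Q : CQ σ) : Prop :=
  ¬ ∃ (D : Type) (e : ℕ ↪ D) (F : FactSet σ D),
    (∀ A ∈ F₀, A.map e ∈ F) ∧ (∀ τ ∈ T, τ.Holds F) ∧ ¬ Q.Holds F ∧ F.DistinguishedTransitive

/-- The query answering problem over transitive relations, for fixed `T` and `Q`: its input is a
finite set of facts, given as a list. -/
def QAtr {σ : Signature} (T : List (DID σ)) (Q : CQ σ) (L : List (Atom σ ℕ)) : Prop :=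
  EntailsTr {A | A ∈ L} T Q

end QueryAnswering

namespace QueryAnswering

/-! The halting problem reduces to query answering. Fix a code `U` that, on the number of a code
`c`, behaves like `c` at 0. A finite Horn program with binary predicates over the natural numbers
computes `U`. A clause is violated exactly when its body holds and its head does not, so both the
clauses and the demand that `U` has no output at `x` become forbidden patterns. The patterns can be
avoided if and only if `U` is undefined at `x` (`exists_avoids_haltingPatterns_iff`): the intended
meaning satisfies the clauses, and every interpretation that satisfies them contains the graph of
`U`.

A countermodel to the query has to store such an interpretation. The dependencies prolong the given
successor chain forever. The distinguished relation contains the successor relation in both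
directions, so transitivity relates any two chain elements, and a disjunctive dependency then
decides every predicate at every pair.

A single conjunctive query must express the disjunction of the patterns. It is the conjunction of
all of them, where a dummy element satisfying every atom makes all but one trivially true; a
selector element determines which pattern has to be matched among the numbers. This gives
`qaTr_iff`. -/

/-! ### Forbidden patterns over the natural numbers. -/

/-- The symbols of a forbidden pattern over the natural numbers: the successor relation, the
singletons of zero and of the input, and the predicates of `I` with their complements. -/
inductive Literal (I : Type) where
  | succ
  | zero
  | input
  | pos (i : I)
  | neg (i : I)
  deriving Fintype

namespace Literal

variable {I : Type}

/-- The meaning of a symbol on the natural numbers, for the input `x`, when the predicates of `I`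
are interpreted by `ρ`. -/
def Interp (x : ℕ) (ρ : I → ℕ → ℕ → Prop) : Literal I → ℕ → ℕ → Prop
  | succ, a, b => b = a + 1
  | zero, a, b => a = 0 ∧ b = 0
  | input, a, b => a = x ∧ b = x
  | pos i, a, b => ρ i a b
  | neg i, a, b => ¬ ρ i a b

end Literal

/-- A conjunction of atoms `l(y, z)` with natural numbers `y`, `z` as variables. -/
abbrev Pattern (I : Type) : Type := List (Literal I × ℕ × ℕ)

/-- The pattern is true in `M` under the assignment `v`. -/
def Pattern.Matches {I D : Type} (M : Literal I → D → D → Prop) (v : ℕ → D) (p : Pattern I) :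
    Prop :=
  ∀ t ∈ p, M t.1 (v t.2.1) (v t.2.2)

/-- The predicates `ρ` on the natural numbers match none of the patterns, for the input `x`. -/
def Avoids {I : Type} {n : ℕ} (P : Fin n → Pattern I) (x : ℕ) (ρ : I → ℕ → ℕ → Prop) : Prop :=
  ∀ j v, ¬ (P j).Matches (Literal.Interp x ρ) v

/-! ### Signature and dependencies. -/

/-- The relation symbols used to encode `n` forbidden patterns over `I`: the transitive relation,
a base copy of it, the symbols of the patterns, and selectors of the patterns. -/
inductive Symb (I : Type) (n : ℕ) where
  | trans
  | all
  | lit (l : Literal I)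
  | sel (j : Fin n)
  deriving Fintype

section

variable (I : Type) [Fintype I] (n : ℕ)

/-- The signature with the binary relation symbols `Symb I n`, of which `trans` is
distinguished. -/
noncomputable def patternSig : Signature where
  numRel := Fintype.card (Symb I n)
  arity _ := 2
  distinguished := {Fintype.equivFin (Symb I n) Symb.trans}
  arity_distinguished _ _ := rfl

theorem maxArity_patternSig : (patternSig I n).maxArity = 2 :=
  Finset.sup_const (s := (Finset.univ : Finset (patternSig I n).Rel))
    ⟨Fintype.equivFin (Symb I n) Symb.trans, Finset.mem_univ _⟩ 2

/-- The relation symbols of `patternSig I n`. -/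
noncomputable def relEquiv : Symb I n ≃ (patternSig I n).Rel := Fintype.equivFin (Symb I n)

variable {I n}

theorem relEquiv_mem_distinguished {s : Symb I n} :
    relEquiv I n s ∈ (patternSig I n).distinguished ↔ s = .trans :=
  Finset.mem_singleton.trans (relEquiv I n).injective.eq_iff

theorem card_distinguished_patternSig : (patternSig I n).distinguished.card = 1 :=
  Finset.card_singleton _

/-- The atom `s(a, b)`. -/
noncomputable def binAtom {α : Type} (s : Symb I n) (a b : α) : Atom (patternSig I n) α :=
  ⟨relEquiv I n s, [a, b], rfl⟩

theorem binAtom_inj {α : Type} {s s' : Symb I n} {a b a' b' : α} :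
    binAtom s a b = binAtom s' a' b' ↔ s = s' ∧ a = a' ∧ b = b' := by
  refine ⟨fun h => ?_, ?_⟩
  · have hr := (relEquiv I n).injective (congrArg Atom.rel h)
    have ha : [a, b] = [a', b'] := congrArg Atom.args h
    simp_all
  · rintro ⟨rfl, rfl, rfl⟩
    rfl

@[simp] theorem args_binAtom {α : Type} (s : Symb I n) (a b : α) :
    (binAtom s a b).args = [a, b] := rfl

@[simp] theorem map_binAtom {α β : Type} (h : α → β) (s : Symb I n) (a b : α) :
    (binAtom s a b).map h = binAtom s (h a) (h b) := rfl

theorem holds₂_iff {D : Type} {F : FactSet (patternSig I n) D} {s : Symb I n} {a b : D} :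
    F.Holds₂ (relEquiv I n s) a b ↔ binAtom s a b ∈ F := by
  constructor
  · rintro ⟨A, hA, hr, ha⟩
    rwa [show binAtom s a b = A from Atom.ext hr.symm ha.symm]
  · exact fun h => ⟨_, h, rfl, rfl⟩

theorem distinguishedTransitive_iff {D : Type} {F : FactSet (patternSig I n) D} :
    F.DistinguishedTransitive ↔ ∀ a b c : D, binAtom Symb.trans a b ∈ F →
      binAtom Symb.trans b c ∈ F → binAtom Symb.trans a c ∈ F := by
  simp only [FactSet.DistinguishedTransitive, ← (relEquiv I n).forall_congr_right,
    relEquiv_mem_distinguished, forall_eq, holds₂_iff]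

/-- The dependency with body `s(0, 1)` and the given heads. -/
noncomputable def binDID (s : Symb I n) (t : Symb I n × ℕ × ℕ) (L : List (Symb I n × ℕ × ℕ))
    (h : ∀ u ∈ t :: L, u.2.1 ≠ u.2.2) : DID (patternSig I n) where
  body := binAtom s 0 1
  heads := (t :: L).map fun u => binAtom u.1 u.2.1 u.2.2
  heads_ne_nil := by simp
  nodup_body := by simp
  nodup_heads := by
    intro A hA
    obtain ⟨u, hu, rfl⟩ := List.mem_map.1 hA
    simpa using h u hu

theorem binDID_holds_iff {D : Type} {F : FactSet (patternSig I n) D} {s : Symb I n}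
    {t : Symb I n × ℕ × ℕ} {L : List (Symb I n × ℕ × ℕ)} {h : ∀ u ∈ t :: L, u.2.1 ≠ u.2.2} :
    (binDID s t L h).Holds F ↔ ∀ a b, binAtom s a b ∈ F → ∃ u ∈ t :: L, ∃ g : ℕ → D,
      g 0 = a ∧ g 1 = b ∧ binAtom u.1 (g u.2.1) (g u.2.2) ∈ F := by
  simp only [DID.Holds, binDID, map_binAtom, args_binAtom, List.mem_map]
  constructor
  · intro H a b hab
    obtain ⟨_, ⟨u, hu, rfl⟩, g, hg, hF⟩ := H (fun k => if k = 0 then a else b) (by simpa using hab)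
    exact ⟨u, hu, g, by simpa using hg 0 (by simp), by simpa using hg 1 (by simp), hF⟩
  · intro H g hg
    obtain ⟨u, hu, g', h0, h1, hF⟩ := H _ _ hg
    exact ⟨_, ⟨u, hu, rfl⟩, g', by simp [h0, h1], hF⟩

variable (I n) in
/-- The dependencies: every element with a predecessor has a successor, `trans` contains the
symmetric closure of the successor relation, `all` contains `trans`, and every predicate of `I` or
its complement holds at every pair of `trans`. -/
noncomputable def patternDeps : List (DID (patternSig I n)) :=
  binDID (.lit .succ) (.lit .succ, 1, 2) [] (by simp) ::
  binDID (.lit .succ) (.trans, 0, 1) [] (by simp) ::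
  binDID (.lit .succ) (.trans, 1, 0) [] (by simp) ::
  binDID .trans (.all, 0, 1) [] (by simp) ::
  (Finset.univ : Finset I).toList.map fun i =>
    binDID .trans (.lit (.pos i), 0, 1) [(.lit (.neg i), 0, 1)] (by simp)

theorem exists_assignment {D : Type} (p : D → Prop) (a b : D) :
    (∃ g : ℕ → D, g 0 = a ∧ g 1 = b ∧ p (g 2)) ↔ ∃ c, p c := by
  constructor
  · rintro ⟨g, rfl, rfl, h⟩
    exact ⟨_, h⟩
  · rintro ⟨c, h⟩
    exact ⟨fun k => if k = 0 then a else if k = 1 then b else c, by simpa using h⟩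

theorem patternDeps_hold_iff {D : Type} {F : FactSet (patternSig I n) D} :
    (∀ τ ∈ patternDeps I n, τ.Holds F) ↔
      (∀ a b, binAtom (.lit .succ) a b ∈ F → ∃ c, binAtom (.lit .succ) b c ∈ F) ∧
      (∀ a b, binAtom (.lit .succ) a b ∈ F → binAtom .trans a b ∈ F) ∧
      (∀ a b, binAtom (.lit .succ) a b ∈ F → binAtom .trans b a ∈ F) ∧
      (∀ a b, binAtom .trans a b ∈ F → binAtom .all a b ∈ F) ∧
      ∀ i a b, binAtom .trans a b ∈ F →
        binAtom (.lit (.pos i)) a b ∈ F ∨ binAtom (.lit (.neg i)) a b ∈ F := by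
  have hg : ∀ (a b : D), ∃ g : ℕ → D, g 0 = a ∧ g 1 = b := fun a b =>
    ⟨fun k => if k = 0 then a else b, by simp⟩
  have h₁ : ∀ (s : Symb I n) (a b : D),
      (∃ g : ℕ → D, g 0 = a ∧ g 1 = b ∧ binAtom s (g 1) (g 2) ∈ F) ↔
        ∃ c, binAtom s b c ∈ F := by
    intro s a b
    rw [← exists_assignment _ a b]
    exact exists_congr fun g => and_congr_right fun _ => and_congr_right fun h => by rw [h]
  have h₂ : ∀ (s : Symb I n) (a b : D),
      (∃ g : ℕ → D, g 0 = a ∧ g 1 = b ∧ binAtom s (g 0) (g 1) ∈ F) ↔ binAtom s a b ∈ F := by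
    refine fun s a b => ⟨?_, fun h => ?_⟩
    · rintro ⟨g, rfl, rfl, h⟩
      exact h
    · obtain ⟨g, rfl, rfl⟩ := hg a b
      exact ⟨g, rfl, rfl, h⟩
  have h₃ : ∀ (s : Symb I n) (a b : D),
      (∃ g : ℕ → D, g 0 = a ∧ g 1 = b ∧ binAtom s (g 1) (g 0) ∈ F) ↔ binAtom s b a ∈ F := by
    refine fun s a b => ⟨?_, fun h => ?_⟩
    · rintro ⟨g, rfl, rfl, h⟩
      exact h
    · obtain ⟨g, rfl, rfl⟩ := hg a b
      exact ⟨g, rfl, rfl, h⟩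
  simp only [patternDeps, List.forall_mem_cons, List.forall_mem_map, binDID_holds_iff]
  simp only [List.mem_cons, List.not_mem_nil, or_false, exists_eq_left, exists_eq_or_imp, h₁, h₂,
    h₃, Finset.mem_toList, Finset.mem_univ, forall_true_left]

/-! ### The query. -/

/-- The variables of the query: the assignment that gives `z`, `u j` and `v j k` to the variables
`⟨0, 0⟩`, `⟨j + 1, 0⟩` and `⟨j + 1, k + 1⟩`. -/
def queryAssignment {D : Type} (z : D) (u : ℕ → D) (v : ℕ → ℕ → D) (m : ℕ) : D :=
  match m.unpair.1, m.unpair.2 with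
  | 0, _ => z
  | j + 1, 0 => u j
  | j + 1, k + 1 => v j k

/-- The query that expresses that some pattern is matched: every pattern has an anchor `u` that
sees all variables of the pattern, and a common element selects the anchors. -/
noncomputable def patternQuery (P : Fin n → Pattern I) : CQ (patternSig I n) where
  atoms := (List.finRange n).flatMap fun j =>
    .rel (binAtom (.sel j) (Nat.pair 0 0) (Nat.pair (j + 1) 0)) ::
    (P j).flatMap fun t =>
      [.rel (binAtom .all (Nat.pair (j + 1) 0) (Nat.pair (j + 1) (t.2.1 + 1))),
       .rel (binAtom .all (Nat.pair (j + 1) 0) (Nat.pair (j + 1) (t.2.2 + 1))),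
       .rel (binAtom (.lit t.1) (Nat.pair (j + 1) (t.2.1 + 1)) (Nat.pair (j + 1) (t.2.2 + 1)))]

theorem patternQuery_onBase (P : Fin n → Pattern I) : (patternQuery P).OnBase := by
  intro φ hφ
  simp only [patternQuery, List.mem_flatMap, List.mem_cons, List.not_mem_nil, or_false] at hφ
  obtain ⟨j, -, rfl | ⟨t, -, rfl | rfl | rfl⟩⟩ := hφ <;>
    simp [AtomicFormula.OnBase, binAtom, relEquiv_mem_distinguished]

theorem patternQuery_holds_iff {D : Type} {F : FactSet (patternSig I n) D}
    {P : Fin n → Pattern I} :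
    (patternQuery P).Holds F ↔ ∃ (z : D) (u : Fin n → D) (v : Fin n → ℕ → D), ∀ j,
      binAtom (.sel j) z (u j) ∈ F ∧ ∀ t ∈ P j, binAtom .all (u j) (v j t.2.1) ∈ F ∧
        binAtom .all (u j) (v j t.2.2) ∈ F ∧
        binAtom (.lit t.1) (v j t.2.1) (v j t.2.2) ∈ F := by
  -- The domain condition on variables is automatic: each argument of a true atom occurs in a fact.
  have hrel : ∀ (h : ℕ → D) (s : Symb I n) (a b : ℕ),
      ((∀ x ∈ (AtomicFormula.rel (binAtom s a b)).vars, h x ∈ F.elems) ∧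
        (AtomicFormula.rel (binAtom s a b)).Holds F h) ↔ binAtom s (h a) (h b) ∈ F := by
    intro h s a b
    refine ⟨fun H => H.2, fun H => ⟨fun x hx => ⟨_, H, ?_⟩, H⟩⟩
    simp only [AtomicFormula.vars, args_binAtom, List.mem_cons, List.not_mem_nil, or_false] at hx
    rcases hx with rfl | rfl <;> simp
  have hiff : (patternQuery P).Holds F ↔ ∃ h : ℕ → D, ∀ j : Fin n,
      binAtom (.sel j) (h (Nat.pair 0 0)) (h (Nat.pair (j + 1) 0)) ∈ F ∧
      ∀ t ∈ P j, binAtom .all (h (Nat.pair (j + 1) 0)) (h (Nat.pair (j + 1) (t.2.1 + 1))) ∈ F ∧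
        binAtom .all (h (Nat.pair (j + 1) 0)) (h (Nat.pair (j + 1) (t.2.2 + 1))) ∈ F ∧
        binAtom (.lit t.1) (h (Nat.pair (j + 1) (t.2.1 + 1)))
          (h (Nat.pair (j + 1) (t.2.2 + 1))) ∈ F := by
    simp only [CQ.Holds, patternQuery, List.forall_mem_flatMap, List.forall_mem_cons, hrel,
      List.mem_finRange, forall_true_left, List.not_mem_nil, false_imp_iff, implies_true,
      and_true]
  rw [hiff]
  constructor
  · rintro ⟨h, H⟩
    exact ⟨_, fun j => h (Nat.pair (j + 1) 0), fun j k => h (Nat.pair (j + 1) (k + 1)), H⟩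
  · rintro ⟨z, u, v, H⟩
    -- Indices `j ≥ n` occur in no atom, so the default `z` there is harmless.
    refine ⟨queryAssignment z (fun j => if h : j < n then u ⟨j, h⟩ else z)
      (fun j k => if h : j < n then v ⟨j, h⟩ k else z), fun j => ?_⟩
    simpa [queryAssignment] using H j

/-! ### The input facts and their computability. -/

/-- The facts that do not depend on the input. The element `2 * i` stands for the number `i`, the
element `1` satisfies every atom, and `2 * k + 3` selects the `k`-th pattern, which is anchored at
zero while all other patterns are anchored at `1`. -/
noncomputable def fixedFacts (I : Type) [Fintype I] (n : ℕ) : List (Atom (patternSig I n) ℕ) :=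
  binAtom (.lit .zero) 0 0 :: binAtom .trans 1 1 :: binAtom .all 1 1 ::
  (((Finset.univ : Finset (Literal I)).toList.map fun l => binAtom (.lit l) 1 1) ++
  (List.finRange n).flatMap fun k : Fin n => (List.finRange n).map fun j : Fin n =>
    binAtom (.sel j) (2 * (k : ℕ) + 3) (if j = k then 0 else 1))

/-- The facts that encode the input `x`. -/
noncomputable def inputFacts (I : Type) [Fintype I] (n x : ℕ) : List (Atom (patternSig I n) ℕ) :=
  fixedFacts I n ++ binAtom (.lit .input) (2 * x) (2 * x) ::
    (List.range (x + 1)).map fun i => binAtom (.lit .succ) (2 * i) (2 * (i + 1))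

theorem primrec_binAtom (s : Symb I n) :
    Primrec fun p : ℕ × ℕ => (binAtom s p.1 p.2 : Atom (patternSig I n) ℕ) := by
  let _ : Primcodable {p : (patternSig I n).Rel × List ℕ // p.2.length = (patternSig I n).arity p.1} :=
    Primcodable.subtype (Atom.primrecPred_length _)
  refine (Primrec.of_equiv_iff (Atom.equivSubtype (patternSig I n) ℕ)).1 ?_
  refine Primrec.subtype_val_iff.1 ?_
  exact Primrec.pair (Primrec.const _) (Primrec.list_cons.comp Primrec.fst
    (Primrec.list_cons.comp Primrec.snd (Primrec.const _)))

theorem primrec_inputFacts : Primrec (inputFacts I n) := by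
  have h2 : Primrec fun i : ℕ => 2 * i := Primrec.nat_mul.comp (Primrec.const 2) Primrec.id
  refine Primrec.list_append.comp (Primrec.const _) (Primrec.list_cons.comp
    ((primrec_binAtom _).comp (Primrec.pair h2 h2))
    (Primrec.list_map (Primrec.list_range.comp Primrec.succ) ?_))
  exact ((primrec_binAtom (I := I) (n := n) (.lit .succ)).comp
    (Primrec.pair h2 (h2.comp Primrec.succ))).comp Primrec.snd

theorem forall_inputFacts_iff {p : Atom (patternSig I n) ℕ → Prop} {x : ℕ} :
    (∀ A ∈ inputFacts I n x, p A) ↔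
      p (binAtom (.lit .zero) 0 0) ∧ p (binAtom .trans 1 1) ∧ p (binAtom .all 1 1) ∧
      (∀ l, p (binAtom (.lit l) 1 1)) ∧
      (∀ k j : Fin n, p (binAtom (.sel j) (2 * k + 3) (if j = k then 0 else 1))) ∧
      p (binAtom (.lit .input) (2 * x) (2 * x)) ∧
      ∀ i < x + 1, p (binAtom (.lit .succ) (2 * i) (2 * (i + 1))) := by
  simp only [inputFacts, fixedFacts, List.forall_mem_append, List.forall_mem_cons,
    List.forall_mem_map, List.forall_mem_flatMap, Finset.mem_toList, Finset.mem_univ,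
    forall_true_left, List.mem_finRange, List.mem_range, and_assoc]

/-! ### From unavoidable patterns to entailment. -/

/-- Extracts the copy of the natural numbers in a model. It may repeat elements, which is harmless
because predicates are pulled back along it. -/
theorem exists_chain {D : Type} (r : D → D → Prop) (hr : ∀ a b, r a b → ∃ c, r b c) (m : ℕ)
    (e : ℕ → D) (he : ∀ i < m + 1, r (e i) (e (i + 1))) :
    ∃ s : ℕ → D, (∀ i ≤ m, s i = e i) ∧ ∀ i, r (s i) (s (i + 1)) := by
  choose! f hf using hr
  have hs : ∃ t : ℕ → D, t 0 = e m ∧ ∀ i, r (t i) (t (i + 1)) := by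
    -- The state is an edge, since a successor is only guaranteed for an element that has a
    -- predecessor.
    let t : ℕ → D × D := fun i => (fun p : D × D => (p.2, f p.1 p.2))^[i] (e m, e (m + 1))
    have ht : ∀ i, r (t i).1 (t i).2 ∧ (t (i + 1)).1 = (t i).2 := by
      intro i
      induction i with
      | zero => exact ⟨he m (by omega), rfl⟩
      | succ i ih =>
        simp only [t, Function.iterate_succ_apply'] at ih ⊢
        exact ⟨hf _ _ ih.1, trivial⟩
    exact ⟨fun i => (t i).1, rfl, fun i => by simpa only [(ht i).2] using (ht i).1⟩
  obtain ⟨t, ht0, ht⟩ := hs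
  refine ⟨fun i => if i ≤ m then e i else t (i - m), fun i hi => if_pos hi, fun i => ?_⟩
  rcases lt_trichotomy i m with h | rfl | h
  · simpa [h.le, Nat.succ_le_of_lt h] using he i (by omega)
  · simpa [ht0] using ht 0
  · simpa [h.not_ge, (h.trans i.lt_succ_self).not_ge, Nat.sub_add_comm h.le] using ht (i - m)

/-- Walk up or down the chain one step at a time; going up and back down gives reflexivity. -/
theorem total_of_chain {D : Type} (r : D → D → Prop) (htrans : ∀ a b c, r a b → r b c → r a c)
    (s : ℕ → D) (h₁ : ∀ i, r (s i) (s (i + 1))) (h₂ : ∀ i, r (s (i + 1)) (s i)) (i j : ℕ) :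
    r (s i) (s j) := by
  have hup : ∀ i k, r (s i) (s (i + k)) := by
    intro i k
    induction k with
    | zero => exact htrans _ _ _ (h₁ i) (h₂ i)
    | succ k ih => exact htrans _ _ _ ih (h₁ _)
  have hdown : ∀ i k, r (s (i + k)) (s i) := by
    intro i k
    induction k with
    | zero => exact htrans _ _ _ (h₁ i) (h₂ i)
    | succ k ih => exact htrans _ _ _ (h₂ _) ih
  rcases le_total i j with h | h
  · obtain ⟨k, rfl⟩ := Nat.exists_eq_add_of_le h
    exact hup i k
  · obtain ⟨k, rfl⟩ := Nat.exists_eq_add_of_le h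
    exact hdown j k

/-- If every interpretation of the predicates on the natural numbers matches a pattern, then the
query is entailed. -/
theorem entailsTr_of_forall_not_avoids {P : Fin n → Pattern I} {x : ℕ}
    (h : ∀ ρ, ¬ Avoids P x ρ) :
    QAtr (patternDeps I n) (patternQuery P) (inputFacts I n x) := by
  rintro ⟨D, e, F, hF₀, hdeps, hQ, htr⟩
  obtain ⟨hzero, -, hall, hlit, hsel, hinput, hsucc⟩ :=
    forall_inputFacts_iff (p := fun A => A.map e ∈ F).1 hF₀
  simp only [map_binAtom] at hzero hall hlit hsel hinput hsucc
  rw [patternDeps_hold_iff] at hdeps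
  obtain ⟨dsucc, dtrans, dtrans', dall, dpred⟩ := hdeps
  rw [distinguishedTransitive_iff] at htr
  obtain ⟨s, hse, hs⟩ := exists_chain _ dsucc x (fun i => e (2 * i)) hsucc
  have htot : ∀ i j, binAtom .trans (s i) (s j) ∈ F :=
    total_of_chain _ htr s (fun i => dtrans _ _ (hs i)) fun i => dtrans' _ _ (hs i)
  -- A model may satisfy both `pos i` and `neg i` at a pair. Reading `ρ` off the positive atoms
  -- suffices: where `ρ` fails, the disjunctive dependency yields the negative atom.
  refine h (fun i a b => binAtom (.lit (.pos i)) (s a) (s b) ∈ F) fun k v hv => hQ ?_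
  have hmem : ∀ l a b, Literal.Interp x (fun i a b => binAtom (.lit (.pos i)) (s a) (s b) ∈ F) l a b →
      binAtom (.lit l) (s a) (s b) ∈ F := by
    rintro (_ | _ | _ | i | i) a b hab
    · obtain rfl : b = a + 1 := hab
      exact hs a
    · obtain ⟨rfl, rfl⟩ : a = 0 ∧ b = 0 := hab
      simpa [hse 0 (Nat.zero_le _)] using hzero
    · obtain ⟨rfl, rfl⟩ : a = x ∧ b = x := hab
      simpa [hse _ le_rfl] using hinput
    · exact hab
    · exact (dpred i _ _ (htot a b)).resolve_left hab
  rw [patternQuery_holds_iff]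
  -- Only the matched pattern `k` is sent to the chain; every other pattern collapses to the dummy
  -- `e 1`.
  refine ⟨e (2 * k + 3), fun j => if j = k then e 0 else e 1,
    fun j m => if j = k then s (v m) else e 1, fun j => ⟨?_, fun t ht => ?_⟩⟩
  · simpa [apply_ite e] using hsel k j
  · by_cases hj : j = k
    · subst hj
      simp only [if_true]
      have h0 : e 0 = s 0 := (hse 0 (Nat.zero_le _)).symm
      rw [h0]
      exact ⟨dall _ _ (htot _ _), dall _ _ (htot _ _), hmem _ _ _ (hv t ht)⟩
    · simp only [if_neg hj]
      exact ⟨hall, hall, hlit _⟩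

/-! ### The canonical countermodel. -/

/-- The facts of the canonical model: the numbers are `Sum.inl i`, the element that satisfies every
atom is `Sum.inr 0`, and `Sum.inr (k + 1)` selects the `k`-th pattern. -/
def CanonicalFact (x : ℕ) (ρ : I → ℕ → ℕ → Prop) : Symb I n → ℕ ⊕ ℕ → ℕ ⊕ ℕ → Prop
  | .sel j, a, b => ∃ k : Fin n, a = .inr (k + 1) ∧ b = if j = k then .inl 0 else .inr 0
  | .lit l, a, b => (∃ i j, a = .inl i ∧ b = .inl j ∧ l.Interp x ρ i j) ∨ a = .inr 0 ∧ b = .inr 0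
  | _, a, b => (∃ i j, a = .inl i ∧ b = .inl j) ∨ a = .inr 0 ∧ b = .inr 0

/-- The canonical model given by an interpretation of the predicates on the natural numbers. -/
def canonicalModel (x : ℕ) (ρ : I → ℕ → ℕ → Prop) : FactSet (patternSig I n) (ℕ ⊕ ℕ) :=
  {A | ∃ s a b, A = binAtom s a b ∧ CanonicalFact x ρ s a b}

theorem binAtom_mem_canonicalModel {x : ℕ} {ρ : I → ℕ → ℕ → Prop} {s : Symb I n} {a b : ℕ ⊕ ℕ} :
    binAtom s a b ∈ canonicalModel x ρ ↔ CanonicalFact x ρ s a b := by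
  constructor
  · rintro ⟨s', a', b', h, H⟩
    obtain ⟨rfl, rfl, rfl⟩ := binAtom_inj.1 h
    exact H
  · exact fun h => ⟨_, _, _, rfl, h⟩

/-- A match of the query must use a selector, say of pattern `k`. That pattern is anchored at the
number zero, from which `all` reaches only numbers, so it would be a genuine match for `ρ`. With no
patterns the query would be empty and true, hence `0 < n`. -/
theorem not_entailsTr_of_avoids {P : Fin n → Pattern I} (hn : 0 < n) {x : ℕ}
    {ρ : I → ℕ → ℕ → Prop} (h : Avoids P x ρ) :
    ¬ QAtr (patternDeps I n) (patternQuery P) (inputFacts I n x) := by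
  refine not_not.2 ⟨ℕ ⊕ ℕ, Equiv.natSumNatEquivNat.symm.toEmbedding, canonicalModel x ρ,
    ?_, ?_, ?_, ?_⟩
  -- Even elements are the numbers, and odd ones are the dummy 1 and the selectors.
  · have he : ∀ i, Equiv.natSumNatEquivNat.symm (2 * i) = .inl i := fun i =>
      Equiv.natSumNatEquivNat.symm_apply_eq.2 (by simp)
    have ho : ∀ i, Equiv.natSumNatEquivNat.symm (2 * i + 1) = .inr i := fun i =>
      Equiv.natSumNatEquivNat.symm_apply_eq.2 (by simp)
    have h0 := he 0
    have h1 := ho 0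
    have hk : ∀ k, Equiv.natSumNatEquivNat.symm (2 * k + 3) = .inr (k + 1) := fun k => ho (k + 1)
    simp only [mul_zero, zero_add] at h0 h1
    refine forall_inputFacts_iff.2 ?_
    simp only [map_binAtom, binAtom_mem_canonicalModel, Equiv.coe_toEmbedding, he, h0, h1, hk,
      apply_ite, CanonicalFact]
    simp only [Literal.Interp]
    simp
    intro k j
    split_ifs with h
    · rw [h]
    · exact ⟨k, h, rfl⟩
  · rw [patternDeps_hold_iff]
    simp only [binAtom_mem_canonicalModel, CanonicalFact]
    refine ⟨?_, ?_, ?_, ?_, ?_⟩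
    · rintro a b (⟨i, j, rfl, rfl, h⟩ | ⟨rfl, rfl⟩)
      · exact ⟨.inl (j + 1), .inl ⟨_, _, rfl, rfl, rfl⟩⟩
      · exact ⟨_, .inr ⟨rfl, rfl⟩⟩
    · rintro a b (⟨i, j, rfl, rfl, h⟩ | ⟨rfl, rfl⟩) <;> simp
    · rintro a b (⟨i, j, rfl, rfl, h⟩ | ⟨rfl, rfl⟩) <;> simp
    · exact fun a b => id
    · rintro i a b (⟨k, l, rfl, rfl⟩ | ⟨rfl, rfl⟩)
      · simp [Literal.Interp, em]
      · simp
  · rw [patternQuery_holds_iff]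
    simp only [binAtom_mem_canonicalModel]
    rintro ⟨z, u, v, H⟩
    obtain ⟨k, rfl, -⟩ := (H ⟨0, hn⟩).1
    obtain ⟨⟨k', hk, hu⟩, hk₂⟩ := H k
    obtain rfl : k = k' := by simpa [Fin.ext_iff] using hk
    rw [if_pos rfl] at hu
    simp only [hu, CanonicalFact] at hk₂
    -- The default 0 only affects variables that do not occur in the pattern.
    refine h k (fun m => (v k m).elim id fun _ => 0) fun t ht => ?_
    obtain ⟨h₁ | h₁, h₂ | h₂, h₃⟩ := hk₂ t ht
    · obtain ⟨-, a, -, ha⟩ := h₁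
      obtain ⟨-, b, -, hb⟩ := h₂
      simpa [ha, hb] using h₃
    all_goals simp at h₁ h₂
  · rw [distinguishedTransitive_iff]
    simp only [binAtom_mem_canonicalModel, CanonicalFact]
    rintro a b c (⟨i, j, rfl, rfl⟩ | ⟨rfl, rfl⟩) (⟨k, l, hk, rfl⟩ | ⟨hk, rfl⟩) <;> simp_all

theorem qaTr_iff {P : Fin n → Pattern I} (hn : 0 < n) {x : ℕ} :
    QAtr (patternDeps I n) (patternQuery P) (inputFacts I n x) ↔ ∀ ρ, ¬ Avoids P x ρ :=
  ⟨fun h _ hρ => not_entailsTr_of_avoids hn hρ h, entailsTr_of_forall_not_avoids⟩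

end

/-! ### A Horn program for partial recursive functions. -/

open Nat.Partrec (Code)

/-- The predicates of the Horn program that computes codes with number below `K`: the order, the
two components of the inverse pairing function, and the graphs of the codes. -/
inductive Predicate (K : ℕ) where
  | lt
  | left
  | right
  | graph (k : Fin K)
  deriving Fintype

namespace Predicate

variable {K : ℕ}

/-- The predicate for the graph of `c`, for codes `c` with number below `K`. -/
def ofCode (K : ℕ) (c : Code) : Predicate K :=
  if h : Encodable.encode c < K then graph ⟨_, h⟩ else lt

/-- The intended meaning of the predicates. -/
def Meaning : Predicate K → ℕ → ℕ → Prop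
  | lt, a, b => a < b
  | left, a, b => a.unpair.1 = b
  | right, a, b => a.unpair.2 = b
  | graph k, a, b => b ∈ (Denumerable.ofNat Code k).eval a

theorem meaning_ofCode {c : Code} (h : Encodable.encode c < K) (a b : ℕ) :
    (ofCode K c).Meaning a b ↔ b ∈ c.eval a := by
  simp [ofCode, h, Meaning]

end Predicate

open Predicate

/-- The pattern that forbids violations of a Horn clause. -/
def hornPattern {I : Type} (body : Pattern I) (i : I) (a b : ℕ) : Pattern I :=
  (.neg i, a, b) :: body

/-- Horn clauses for the order and the inverse of the pairing function. -/
def arithmeticPatterns (K : ℕ) : List (Pattern (Predicate K)) :=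
  [hornPattern [(.succ, 0, 1)] lt 0 1,
   hornPattern [(.pos lt, 0, 1), (.succ, 1, 2)] lt 0 2,
   hornPattern [(.zero, 0, 0)] left 0 0,
   hornPattern [(.zero, 0, 0)] right 0 0,
   hornPattern [(.succ, 0, 1), (.pos left, 0, 2), (.pos right, 0, 3), (.succ, 2, 4),
     (.pos lt, 4, 3)] left 1 4,
   hornPattern [(.succ, 0, 1), (.pos left, 0, 2), (.pos right, 0, 3), (.succ, 2, 4),
     (.pos lt, 4, 3)] right 1 3,
   hornPattern [(.succ, 0, 1), (.pos left, 0, 2), (.pos right, 0, 3), (.succ, 2, 3),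
     (.zero, 4, 4)] left 1 3,
   hornPattern [(.succ, 0, 1), (.pos left, 0, 2), (.pos right, 0, 3), (.succ, 2, 3),
     (.zero, 4, 4)] right 1 4,
   hornPattern [(.succ, 0, 1), (.pos left, 0, 2), (.pos right, 0, 3), (.pos lt, 3, 2),
     (.succ, 3, 4)] left 1 2,
   hornPattern [(.succ, 0, 1), (.pos left, 0, 2), (.pos right, 0, 3), (.pos lt, 3, 2),
     (.succ, 3, 4)] right 1 4,
   hornPattern [(.succ, 0, 1), (.pos left, 0, 2), (.pos right, 0, 2), (.succ, 2, 3),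
     (.zero, 4, 4)] left 1 4,
   hornPattern [(.succ, 0, 1), (.pos left, 0, 2), (.pos right, 0, 2), (.succ, 2, 3),
     (.zero, 4, 4)] right 1 3]

/-- Horn clauses for the graph of a code, in terms of the graphs of its immediate subcodes. -/
def codePatterns (K : ℕ) : Code → List (Pattern (Predicate K))
  | .zero => [hornPattern [(.zero, 1, 1)] (ofCode K .zero) 0 1]
  | .succ => [hornPattern [(.succ, 0, 1)] (ofCode K .succ) 0 1]
  | .left => [hornPattern [(.pos left, 0, 1)] (ofCode K .left) 0 1]
  | .right => [hornPattern [(.pos right, 0, 1)] (ofCode K .right) 0 1]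
  | .pair f g =>
    [hornPattern [(.pos (ofCode K f), 0, 1), (.pos (ofCode K g), 0, 2), (.pos left, 3, 1),
      (.pos right, 3, 2)] (ofCode K (.pair f g)) 0 3]
  | .comp f g =>
    [hornPattern [(.pos (ofCode K g), 0, 1), (.pos (ofCode K f), 1, 2)]
      (ofCode K (.comp f g)) 0 2]
  | .prec f g =>
    [hornPattern [(.pos left, 0, 1), (.pos right, 0, 2), (.zero, 2, 2), (.pos (ofCode K f), 1, 3)]
      (ofCode K (.prec f g)) 0 3,
     hornPattern [(.pos left, 0, 1), (.pos right, 0, 2), (.succ, 3, 2), (.pos left, 4, 1),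
      (.pos right, 4, 3), (.pos (ofCode K (.prec f g)), 4, 5), (.pos left, 6, 3),
      (.pos right, 6, 5), (.pos left, 7, 1), (.pos right, 7, 6), (.pos (ofCode K g), 7, 8)]
      (ofCode K (.prec f g)) 0 8]
  | .rfind' f =>
    [hornPattern [(.pos (ofCode K f), 0, 1), (.zero, 1, 1), (.pos right, 0, 2)]
      (ofCode K (.rfind' f)) 0 2,
     hornPattern [(.pos (ofCode K f), 0, 1), (.succ, 2, 1), (.pos left, 0, 3), (.pos right, 0, 4),
      (.succ, 4, 5), (.pos left, 6, 3), (.pos right, 6, 5), (.pos (ofCode K (.rfind' f)), 6, 7)]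
      (ofCode K (.rfind' f)) 0 7]

/-- The patterns that express that the code `U` is undefined at the input. -/
def haltingPatterns (U : Code) : List (Pattern (Predicate (Encodable.encode U + 1))) :=
  [(.input, 0, 0), (.pos (ofCode _ U), 0, 1)] :: (arithmeticPatterns _ ++
    (List.range (Encodable.encode U + 1)).flatMap fun k => codePatterns _ (Denumerable.ofNat Code k))

section Semantics

variable {I : Type} {x : ℕ} {ρ : I → ℕ → ℕ → Prop}

/-- The Horn clause holds in the interpretation `ρ`. -/
theorem not_matches_hornPattern {body : Pattern I} {i : I} {a b : ℕ} {v : ℕ → ℕ} :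
    ¬ (hornPattern body i a b).Matches (Literal.Interp x ρ) v ↔
      (body.Matches (Literal.Interp x ρ) v → ρ i (v a) (v b)) := by
  simp only [Pattern.Matches, hornPattern, List.forall_mem_cons, Literal.Interp]
  tauto

theorem matches_nil {v : ℕ → ℕ} : Pattern.Matches (Literal.Interp x ρ) v [] ↔ True := by
  simp [Pattern.Matches]

theorem matches_cons {v : ℕ → ℕ} {t : Literal I × ℕ × ℕ} {p : Pattern I} :
    Pattern.Matches (Literal.Interp x ρ) v (t :: p) ↔
      t.1.Interp x ρ (v t.2.1) (v t.2.2) ∧ p.Matches (Literal.Interp x ρ) v := by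
  simp [Pattern.Matches]

end Semantics

/-- The pairing function enumerates the shells `max a b = m` in turn, each in the order `(0, m), …,
(m - 1, m), (m, 0), …, (m, m)`. The four cases are the possible moves, and each is expressible by
Horn clauses in the successor and the order. -/
theorem unpair_succ (n : ℕ) : (n + 1).unpair =
    if n.unpair.1 + 1 < n.unpair.2 then (n.unpair.1 + 1, n.unpair.2)
    else if n.unpair.1 + 1 = n.unpair.2 then (n.unpair.2, 0)
    else if n.unpair.2 < n.unpair.1 then (n.unpair.1, n.unpair.2 + 1)
    else (0, n.unpair.1 + 1) := by
  obtain ⟨a, b, rfl⟩ : ∃ a b, n = Nat.pair a b := ⟨_, _, (Nat.pair_unpair n).symm⟩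
  simp only [Nat.unpair_pair]
  have key : ∀ c d, Nat.pair a b + 1 = Nat.pair c d → (Nat.pair a b + 1).unpair = (c, d) :=
    fun c d h => by rw [h, Nat.unpair_pair]
  split_ifs with h₁ h₂ h₃ <;> apply key
  · simp only [Nat.pair, if_pos (show a < b by omega), if_pos h₁]
    ring
  · subst h₂
    simp [Nat.pair]
    ring
  · simp only [Nat.pair, if_neg (show ¬ a < b by omega), if_neg (show ¬ a < b + 1 by omega)]
    ring
  · obtain rfl : a = b := by omega
    simp [Nat.pair]
    ring

theorem mem_eval_pair {f g : Code} {w y : ℕ} :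
    y ∈ (Code.pair f g).eval w ↔ ∃ a ∈ f.eval w, ∃ b ∈ g.eval w, Nat.pair a b = y := by
  simp [Code.eval, Seq.seq]

theorem mem_eval_comp {f g : Code} {w y : ℕ} :
    y ∈ (Code.comp f g).eval w ↔ ∃ a ∈ g.eval w, y ∈ f.eval a := by
  exact Part.mem_bind_iff

/-- The search returns the absolute position `n + m`, not the offset `n`; a failed test at `m`
therefore passes on the value found from `m + 1` unchanged, as the clauses require. -/
theorem mem_eval_rfind' {f : Code} {a m y : ℕ} :
    y ∈ (Code.rfind' f).eval (Nat.pair a m) ↔ ∃ n, y = n + m ∧ 0 ∈ f.eval (Nat.pair a (n + m)) ∧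
      ∀ k < n, ∃ z, z + 1 ∈ f.eval (Nat.pair a (k + m)) := by
  simp only [Code.eval, Nat.unpaired, Nat.unpair_pair, Part.mem_map_iff]
  constructor
  · rintro ⟨n, hn, rfl⟩
    obtain ⟨h₁, h₂⟩ := Nat.mem_rfind.1 hn
    refine ⟨n, rfl, by simpa using h₁, fun k hk => ?_⟩
    obtain ⟨z, hz, h0⟩ := (Part.mem_map_iff _).1 (h₂ hk)
    cases z with
    | zero => simp at h0
    | succ z => exact ⟨z, hz⟩
  · rintro ⟨n, rfl, h₁, h₂⟩
    refine ⟨n, Nat.mem_rfind.2 ⟨(Part.mem_map_iff _).2 ⟨0, h₁, by simp⟩, fun {k} hk => ?_⟩, rfl⟩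
    obtain ⟨z, hz⟩ := h₂ k hk
    exact (Part.mem_map_iff _).2 ⟨_, hz, by simp⟩

theorem forall_haltingPatterns_iff {U : Code} {p : Pattern (Predicate _) → Prop} :
    (∀ q ∈ haltingPatterns U, p q) ↔
      p [(.input, 0, 0), (.pos (ofCode _ U), 0, 1)] ∧ (∀ q ∈ arithmeticPatterns _, p q) ∧
      ∀ c : Code, Encodable.encode c < Encodable.encode U + 1 → ∀ q ∈ codePatterns _ c, p q := by
  simp only [haltingPatterns, List.forall_mem_cons, List.forall_mem_append, List.forall_mem_flatMap,
    List.mem_range]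
  refine and_congr_right fun _ => and_congr_right fun _ => ⟨fun h c hc => ?_, fun h k hk => ?_⟩
  · simpa using h _ hc
  · exact h _ (by simpa using hk)

/-! ### Soundness: the intended meaning satisfies the clauses. -/

theorem arithmetic_sound {K x : ℕ} (v : ℕ → ℕ) :
    ∀ p ∈ arithmeticPatterns K, ¬ p.Matches (Literal.Interp x Meaning) v := by
  simp only [arithmeticPatterns, List.forall_mem_cons, not_matches_hornPattern, matches_cons,
    matches_nil, Literal.Interp, Meaning, List.not_mem_nil, false_imp_iff, implies_true, and_true]
  refine ⟨?_, ?_, ?_, ?_, ?_, ?_, ?_, ?_, ?_, ?_, ?_, ?_⟩ <;> intro h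
  · omega
  · omega
  · simp [h]
  · simp [h]
  all_goals
    rw [h.1, unpair_succ]
    grind

theorem code_sound {K x : ℕ} {c : Code} (hc : Encodable.encode c < K) (v : ℕ → ℕ) :
    ∀ p ∈ codePatterns K c, ¬ p.Matches (Literal.Interp x Meaning) v := by
  have hl : ∀ a b, (left : Predicate K).Meaning a b ↔ a.unpair.1 = b := fun _ _ => Iff.rfl
  have hr : ∀ a b, (right : Predicate K).Meaning a b ↔ a.unpair.2 = b := fun _ _ => Iff.rfl
  -- The clauses describe a pair only through its two components, which determine it.
  have hp : ∀ {w a b : ℕ}, w.unpair.1 = a → w.unpair.2 = b → w = Nat.pair a b := by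
    rintro w _ _ rfl rfl
    exact (Nat.pair_unpair w).symm
  cases c with
  | zero | succ | left | right =>
    simp +contextual [codePatterns, not_matches_hornPattern, matches_cons, matches_nil,
      Literal.Interp, hl, hr, meaning_ofCode hc, Code.eval, pure, PFun.pure]
  | pair f g =>
    obtain ⟨hf, hg⟩ := Code.encode_lt_pair f g
    simp only [codePatterns, List.forall_mem_singleton, not_matches_hornPattern, matches_cons,
      matches_nil, Literal.Interp, hl, hr, meaning_ofCode hc, meaning_ofCode (hf.trans hc),
      meaning_ofCode (hg.trans hc), mem_eval_pair]
    rintro ⟨h₁, h₂, h₃, h₄, -⟩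
    exact ⟨_, h₁, _, h₂, (hp h₃ h₄).symm⟩
  | comp f g =>
    obtain ⟨hf, hg⟩ := Code.encode_lt_comp f g
    simp only [codePatterns, List.forall_mem_singleton, not_matches_hornPattern, matches_cons,
      matches_nil, Literal.Interp, meaning_ofCode hc, meaning_ofCode (hf.trans hc),
      meaning_ofCode (hg.trans hc), mem_eval_comp]
    exact fun ⟨h₁, h₂, _⟩ => ⟨_, h₁, h₂⟩
  | prec f g =>
    obtain ⟨hf, hg⟩ := Code.encode_lt_prec f g
    simp only [codePatterns, List.forall_mem_cons, List.not_mem_nil, false_imp_iff, implies_true,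
      and_true, not_matches_hornPattern, matches_cons, matches_nil, Literal.Interp, hl, hr,
      meaning_ofCode hc, meaning_ofCode (hf.trans hc), meaning_ofCode (hg.trans hc)]
    constructor
    · rintro ⟨h₁, h₂, ⟨h₃, -⟩, h₄⟩
      rw [hp h₁ (h₂.trans h₃)]
      simpa using h₄
    · rintro ⟨h₁, h₂, h₃, h₄, h₅, h₆, h₇, h₈, h₉, h₁₀, h₁₁⟩
      rw [hp h₁ (h₂.trans h₃), Code.eval_prec_succ]
      rw [hp h₄ h₅] at h₆
      rw [hp h₉ h₁₀, hp h₇ h₈] at h₁₁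
      exact Part.mem_bind h₆ h₁₁
  | rfind' f =>
    have hf := Code.encode_lt_rfind' f
    simp only [codePatterns, List.forall_mem_cons, List.not_mem_nil, false_imp_iff, implies_true,
      and_true, not_matches_hornPattern, matches_cons, matches_nil, Literal.Interp, hl, hr,
      meaning_ofCode hc, meaning_ofCode (hf.trans hc)]
    constructor
    · rintro ⟨h₁, ⟨h₂, -⟩, h₃⟩
      rw [h₂, hp rfl h₃] at h₁
      rw [hp rfl h₃]
      exact mem_eval_rfind'.2 ⟨0, by simp, by simpa using h₁, by simp⟩
    · rintro ⟨h₁, h₂, h₃, h₄, h₅, h₆, h₇, h₈⟩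
      rw [hp h₆ (h₇.trans h₅), mem_eval_rfind'] at h₈
      rw [hp h₃ h₄, h₂] at h₁
      rw [hp h₃ h₄, mem_eval_rfind']
      obtain ⟨n, hn, h0, hlt⟩ := h₈
      refine ⟨n + 1, by omega, by convert h0 using 3; ring, ?_⟩
      rintro (_ | k) hk
      · exact ⟨_, by simpa using h₁⟩
      · obtain ⟨z, hz⟩ := hlt k (by omega)
        exact ⟨z, by convert hz using 3; ring⟩

/-! ### Completeness: the clauses force every true value. -/

section Complete

variable {K x : ℕ} {ρ : Predicate K → ℕ → ℕ → Prop}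

theorem arithmetic_complete
    (h : ∀ p ∈ arithmeticPatterns K, ∀ v, ¬ p.Matches (Literal.Interp x ρ) v) (a : ℕ) :
    ρ left a a.unpair.1 ∧ ρ right a a.unpair.2 := by
  simp only [arithmeticPatterns, List.forall_mem_cons, not_matches_hornPattern, matches_cons,
    matches_nil, Literal.Interp, List.not_mem_nil, false_imp_iff, implies_true, and_true] at h
  obtain ⟨hlt₁, hlt₂, hl, hr, hl₁, hr₁, hl₂, hr₂, hl₃, hr₃, hl₄, hr₄⟩ := h
  have hlt : ∀ a k, ρ lt a (a + k + 1) := by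
    intro a k
    induction k with
    -- Here and below, a clause is applied by listing the values of its variables `0, 1, …` in
    -- order; variables beyond the list get 0.
    | zero => simpa using hlt₁ fun i => [a, a + 1].getD i 0
    | succ k ih => exact hlt₂ (fun i => [a, a + k + 1, a + (k + 1) + 1].getD i 0) ⟨ih, rfl⟩
  replace hlt : ∀ a b, a < b → ρ lt a b := by
    intro a b hab
    obtain ⟨k, rfl⟩ := Nat.exists_eq_add_of_lt hab
    exact hlt a k
  induction a with
  | zero => exact ⟨by simpa using hl fun _ => 0, by simpa using hr fun _ => 0⟩
  | succ n ih =>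
    obtain ⟨ihl, ihr⟩ := ih
    rw [unpair_succ]
    generalize n.unpair.1 = a at *
    generalize n.unpair.2 = b at *
    split_ifs with h₁ h₂ h₃
    · exact ⟨by simpa [ihl, ihr, hlt _ _ h₁] using hl₁ fun i => [n, n + 1, a, b, a + 1].getD i 0,
        by simpa [ihl, ihr, hlt _ _ h₁] using hr₁ fun i => [n, n + 1, a, b, a + 1].getD i 0⟩
    · exact ⟨by simpa [ihl, ihr, h₂] using hl₂ fun i => [n, n + 1, a, b, 0].getD i 0,
        by simpa [ihl, ihr, h₂] using hr₂ fun i => [n, n + 1, a, b, 0].getD i 0⟩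
    · exact ⟨by simpa [ihl, ihr, hlt _ _ h₃] using hl₃ fun i => [n, n + 1, a, b, b + 1].getD i 0,
        by simpa [ihl, ihr, hlt _ _ h₃] using hr₃ fun i => [n, n + 1, a, b, b + 1].getD i 0⟩
    · obtain rfl : a = b := by omega
      exact ⟨by simpa [ihl, ihr] using hl₄ fun i => [n, n + 1, a, a + 1, 0].getD i 0,
        by simpa [ihl, ihr] using hr₄ fun i => [n, n + 1, a, a + 1, 0].getD i 0⟩

/-- Induction on the code follows the computation. Subcodes have smaller numbers, so their graphs
are among the predicates. -/
theorem code_complete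
    (h : ∀ c, Encodable.encode c < K →
      ∀ p ∈ codePatterns K c, ∀ v, ¬ p.Matches (Literal.Interp x ρ) v)
    (hlr : ∀ a, ρ left a a.unpair.1 ∧ ρ right a a.unpair.2) (c : Code)
    (hc : Encodable.encode c < K) (w y : ℕ) (hy : y ∈ c.eval w) : ρ (ofCode K c) w y := by
  have hl : ∀ a b, ρ left (Nat.pair a b) a := fun a b => by simpa using (hlr (Nat.pair a b)).1
  have hr : ∀ a b, ρ right (Nat.pair a b) b := fun a b => by simpa using (hlr (Nat.pair a b)).2
  induction c generalizing w y with
  | zero | succ | left | right =>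
    specialize h _ hc
    simp only [codePatterns, List.forall_mem_singleton, not_matches_hornPattern, matches_cons,
      matches_nil, Literal.Interp] at h
    have := h fun i => [w, y].getD i 0
    simp [Code.eval, pure, PFun.pure] at hy
    simpa [hy, hlr] using this
  | pair f g ihf ihg =>
    obtain ⟨hf, hg⟩ := Code.encode_lt_pair f g
    obtain ⟨a, ha, b, hb, rfl⟩ := mem_eval_pair.1 hy
    specialize h _ hc
    simp only [codePatterns, List.forall_mem_singleton, not_matches_hornPattern, matches_cons,
      matches_nil, Literal.Interp] at h
    exact h (fun i => [w, a, b, Nat.pair a b].getD i 0)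
      ⟨ihf (hf.trans hc) _ _ ha, ihg (hg.trans hc) _ _ hb,
        hl _ _, hr _ _, trivial⟩
  | comp f g ihf ihg =>
    obtain ⟨hf, hg⟩ := Code.encode_lt_comp f g
    obtain ⟨a, ha, hy⟩ := mem_eval_comp.1 hy
    specialize h _ hc
    simp only [codePatterns, List.forall_mem_singleton, not_matches_hornPattern, matches_cons,
      matches_nil, Literal.Interp] at h
    exact h (fun i => [w, a, y].getD i 0)
      ⟨ihg (hg.trans hc) _ _ ha, ihf (hf.trans hc) _ _ hy,
        trivial⟩
  | prec f g ihf ihg =>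
    obtain ⟨hf, hg⟩ := Code.encode_lt_prec f g
    specialize h _ hc
    simp only [codePatterns, List.forall_mem_cons, List.not_mem_nil, false_imp_iff, implies_true,
      and_true, not_matches_hornPattern, matches_cons, matches_nil, Literal.Interp] at h
    obtain ⟨h₁, h₂⟩ := h
    obtain ⟨a, n, rfl⟩ : ∃ a n, w = Nat.pair a n := ⟨_, _, (Nat.pair_unpair w).symm⟩
    induction n generalizing y with
    | zero =>
      rw [Code.eval_prec_zero] at hy
      exact h₁ (fun i => [Nat.pair a 0, a, 0, y].getD i 0)
        ⟨hl a 0, hr a 0, ⟨rfl, rfl⟩, ihf (hf.trans hc) _ _ hy⟩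
    | succ n ih =>
      rw [Code.eval_prec_succ] at hy
      obtain ⟨z, hz, hy⟩ := Part.mem_bind_iff.1 hy
      exact h₂ (fun i => [Nat.pair a (n + 1), a, n + 1, n, Nat.pair a n, z, Nat.pair n z,
        Nat.pair a (Nat.pair n z), y].getD i 0)
        ⟨hl _ _, hr _ _, rfl, hl _ _, hr _ _, ih _ hz, hl _ _, hr _ _, hl _ _, hr _ _,
          ihg (hg.trans hc) _ _ hy⟩
  | rfind' f ihf =>
    have hf := (Code.encode_lt_rfind' f).trans hc
    specialize h _ hc
    simp only [codePatterns, List.forall_mem_cons, List.not_mem_nil, false_imp_iff, implies_true,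
      and_true, not_matches_hornPattern, matches_cons, matches_nil, Literal.Interp] at h
    obtain ⟨h₁, h₂⟩ := h
    obtain ⟨a, m, rfl⟩ : ∃ a m, w = Nat.pair a m := ⟨_, _, (Nat.pair_unpair w).symm⟩
    obtain ⟨n, rfl, h0, hlt⟩ := mem_eval_rfind'.1 hy
    clear hy
    -- Induction on the number of failed tests; the start `m` of the search moves up by one each
    -- time.
    induction n generalizing m with
    | zero =>
      rw [zero_add] at h0 ⊢
      exact h₁ (fun i => [Nat.pair a m, 0, m].getD i 0)
        ⟨ihf hf _ _ h0, ⟨rfl, rfl⟩, hr _ _⟩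
    | succ n ih =>
      obtain ⟨z, hz⟩ := hlt 0 n.succ_pos
      rw [zero_add] at hz
      have heq : n + 1 + m = n + (m + 1) := by ring
      rw [heq] at h0 ⊢
      refine h₂ (fun i => [Nat.pair a m, z + 1, z, a, m, m + 1, Nat.pair a (m + 1),
        n + (m + 1)].getD i 0)
        ⟨ihf hf _ _ hz, rfl, hl _ _, hr _ _, rfl, hl _ _, hr _ _,
          ih _ h0 fun k hk => ?_⟩
      obtain ⟨z, hz⟩ := hlt (k + 1) (by omega)
      exact ⟨z, by convert hz using 3; ring⟩

end Complete

/-! ### The reduction from the halting problem. -/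

/-- The patterns for `U` can be avoided exactly at the inputs at which `U` is undefined. -/
theorem exists_avoids_haltingPatterns_iff {U : Code} {x : ℕ} :
    (∃ ρ, Avoids (haltingPatterns U).get x ρ) ↔ ¬ (U.eval x).Dom := by
  have key : ∀ ρ, Avoids (haltingPatterns U).get x ρ ↔
      ∀ p ∈ haltingPatterns U, ∀ v, ¬ p.Matches (Literal.Interp x ρ) v := fun ρ =>
    (List.forall_mem_iff_get (p := fun p : Pattern _ =>
      ∀ v, ¬ p.Matches (Literal.Interp x ρ) v)).symm
  simp only [key, forall_haltingPatterns_iff]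
  constructor
  · rintro ⟨ρ, hU, harith, hcode⟩ hx
    obtain ⟨y, hy⟩ := Part.dom_iff_mem.1 hx
    have := code_complete hcode (arithmetic_complete harith) U (Nat.lt_succ_self _) x y hy
    refine hU (fun i => [x, y].getD i 0) ?_
    simpa [matches_cons, matches_nil, Literal.Interp] using this
  · intro hx
    refine ⟨Meaning, fun v hv => ?_, fun p hp v => arithmetic_sound v p hp,
      fun c hc p hp v => code_sound hc v p hp⟩
    simp only [matches_cons, Literal.Interp, meaning_ofCode (Nat.lt_succ_self _)] at hv
    obtain ⟨⟨h, -⟩, h', -⟩ := hv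
    rw [h] at h'
    exact hx (Part.dom_iff_mem.2 ⟨_, h'⟩)

/-- The dependencies and the query must be fixed, so the program to be tested has to enter through
the input of one fixed code. -/
theorem exists_universal_code :
    ∃ U : Code, ∀ c : Code, U.eval (Encodable.encode c) = c.eval 0 := by
  have h : Partrec fun k : ℕ => (Denumerable.ofNat Code k).eval 0 :=
    Code.eval_part.comp (Computable.ofNat Code) (Computable.const 0)
  obtain ⟨U, hU⟩ := Code.exists_code.1 (Partrec.nat_iff.1 h)
  exact ⟨U, fun c => by simp [hU]⟩

end QueryAnswering

theorem mainTheorem11 :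
    ∃ (σ : QueryAnswering.Signature) (T : List (QueryAnswering.DID σ)) (Q : QueryAnswering.CQ σ),
      σ.maxArity = 2 ∧ σ.distinguished.card = 1 ∧ Q.OnBase ∧
        ¬ ComputablePred (QueryAnswering.QAtr T Q) := by
  obtain ⟨U, hU⟩ := QueryAnswering.exists_universal_code
  refine ⟨_, QueryAnswering.patternDeps _ _,
    QueryAnswering.patternQuery (QueryAnswering.haltingPatterns U).get,
    QueryAnswering.maxArity_patternSig _ _, QueryAnswering.card_distinguished_patternSig,
    QueryAnswering.patternQuery_onBase _, fun h => ComputablePred.halting_problem 0 ?_⟩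
  refine ComputablePred.computable_of_manyOneReducible ⟨fun c =>
    QueryAnswering.inputFacts _ _ (Encodable.encode c),
    (QueryAnswering.primrec_inputFacts.comp Primrec.encode).to_comp, fun c => ?_⟩ h
  rw [QueryAnswering.qaTr_iff (by simp [QueryAnswering.haltingPatterns]), ← not_exists,
    QueryAnswering.exists_avoids_haltingPatterns_iff, not_not, hU]
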